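/- Let $(E_n)_{n\ge 0}$ be the Euler numbers, defined by $E_0=1$, and, for every $n\ge 1$, $E_{2n-1}=0$ and $\sum_{r=0}^{n}\binom{2n}{2r}E_{2r}=0$. Let $k$ and $m$ be positive integers with $m\ge 2$. Then $$E_{2^mk}\equiv\begin{cases}4k(-48k^2+60k-11)+1 \pmod{2^{m+7}} & \text{if } m=2,\\ 2^mk(-11+7\cdot 2^mk)+1 \pmod{2^{m+7}} & \text{if } m\ge 3,\end{cases}$$ and $$E_{2^mk+2}\equiv\begin{cases}4k(-48k^2-12k+45)-1 \pmod{2^{m+7}} & \text{if } m=2,\\ 2^mk(45+5\cdot 2^mk)-1 \pmod{2^{m+7}} & \text{if } m\ge 3.\end{cases}$$ -/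

import Mathlib

/-- The Euler numbers `E_n`: `E_0 = 1`, `E_n = 0` for odd `n`, and, for even `n > 0`, the value
`E_n = - ∑_{0 ≤ r < n/2} (n choose 2r) E_{2r}`, i.e. the recursion
`∑_{r=0}^{n} (2n choose 2r) E_{2r} = 0` for `n ≥ 1` solved for its last term. The three defining
properties are verified right below. -/
def eulerNumber (n : ℕ) : ℤ :=
  if n = 0 then 1
  else if n % 2 = 1 then 0
  else -∑ r : Fin (n / 2), (n.choose (2 * (r : ℕ)) : ℤ) * eulerNumber (2 * (r : ℕ))
termination_by n
decreasing_by
  have := r.isLt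
  omega

theorem eulerNumber_zero : eulerNumber 0 = 1 := by
  rw [eulerNumber]; simp

theorem eulerNumber_odd (n : ℕ) (hn : 1 ≤ n) : eulerNumber (2 * n - 1) = 0 := by
  rw [eulerNumber, if_neg (by omega), if_pos (by omega)]

theorem eulerNumber_sum (n : ℕ) (hn : 1 ≤ n) :
    ∑ r ∈ Finset.range (n + 1), ((2 * n).choose (2 * r) : ℤ) * eulerNumber (2 * r) = 0 := by
  have h : eulerNumber (2 * n) =
      -∑ r ∈ Finset.range n, ((2 * n).choose (2 * r) : ℤ) * eulerNumber (2 * r) := by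
    rw [eulerNumber, if_neg (by omega), if_neg (by omega),
      Fin.sum_univ_eq_sum_range
        (fun r : ℕ => ((2 * n).choose (2 * r) : ℤ) * eulerNumber (2 * r)) (2 * n / 2),
      Nat.mul_div_cancel_left n (by norm_num)]
  rw [Finset.sum_range_succ, h]
  simp

/-! ### The umbral functional and its shift identity. -/

open Polynomial

/-! Let L send `X ^ n` to `E_n`. The Euler recursion says L(f(X+1) + f(X-1)) = 2 f(0), which
evaluates L on products of X² - i² over odd i (`eulerFunctional_oddCentralFactorial`). Hence L((X² -
1)^r) is divisible by 2^⌊3r/2⌋ (`two_pow_dvd_eulerMoment`).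

Expanding X^(2j) = (1 + (X² - 1))^j writes `E_{2j}` as a binomial sum of these moments. If 2^n
divides j, the terms with r ≥ 6 vanish modulo 2^(n+8) (`two_pow_dvd_choose_mul`), leaving an
explicit quintic in j. The theorem is the case n = m - 1, j = 2^(m-1) k. -/

/-- The umbral functional `X ^ n ↦ E_n`. -/
noncomputable def eulerFunctional : ℤ[X] →ₗ[ℤ] ℤ :=
  Polynomial.lsum fun n => LinearMap.mulRight ℤ (eulerNumber n)

theorem eulerFunctional_X_pow (n : ℕ) : eulerFunctional (X ^ n) = eulerNumber n := by
  rw [eulerFunctional, Polynomial.lsum_apply, ← Polynomial.monomial_one_right_eq_X_pow,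
    Polynomial.sum_monomial_index] <;> simp

theorem eulerNumber_of_odd {n : ℕ} (hn : Odd n) : eulerNumber n = 0 := by
  obtain ⟨a, rfl⟩ := hn
  exact eulerNumber_odd (a + 1) (by omega)

theorem sum_range_two_mul_add_one (f : ℕ → ℤ) (a : ℕ) :
    ∑ i ∈ Finset.range (2 * a + 1), f i =
      ∑ r ∈ Finset.range (a + 1), f (2 * r) + ∑ r ∈ Finset.range a, f (2 * r + 1) := by
  induction a with
  | zero => simp
  | succ a ih =>
    rw [show 2 * (a + 1) + 1 = 2 * a + 1 + 1 + 1 by ring, Finset.sum_range_succ,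
      Finset.sum_range_succ, ih, Finset.sum_range_succ (fun r => f (2 * r)) (a + 1),
      Finset.sum_range_succ (fun r => f (2 * r + 1)) a,
      show 2 * (a + 1) = 2 * a + 1 + 1 by ring]
    ring

theorem eulerFunctional_shift_X_pow (n : ℕ) :
    eulerFunctional ((X + 1) ^ n + (X - 1) ^ n) = 2 * (0 : ℤ) ^ n := by
  have expand : eulerFunctional ((X + 1) ^ n + (X - 1) ^ n) =
      ∑ i ∈ Finset.range (n + 1), (1 + (-1) ^ (n - i)) * ((n.choose i : ℤ) * eulerNumber i) := by
    rw [sub_eq_add_neg, add_pow, add_pow, ← Finset.sum_add_distrib, map_sum]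
    refine Finset.sum_congr rfl fun i _ => ?_
    have : (X ^ i * 1 ^ (n - i) * (n.choose i : ℤ[X]) + X ^ i * (-1) ^ (n - i) * (n.choose i : ℤ[X]))
        = (((1 + (-1) ^ (n - i)) * (n.choose i : ℤ) : ℤ)) • (X ^ i : ℤ[X]) := by
      rw [zsmul_eq_mul]; push_cast; ring
    rw [this, map_smul, eulerFunctional_X_pow, smul_eq_mul, mul_assoc]
  rw [expand]
  rcases Nat.even_or_odd' n with ⟨a, rfl | rfl⟩
  · rcases Nat.eq_zero_or_pos a with rfl | ha
    · simp [eulerNumber_zero]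
    rw [zero_pow (by omega), mul_zero, sum_range_two_mul_add_one,
      Finset.sum_eq_zero (s := Finset.range a), add_zero]
    · calc _ = ∑ r ∈ Finset.range (a + 1),
            2 * (((2 * a).choose (2 * r) : ℤ) * eulerNumber (2 * r)) := by
            refine Finset.sum_congr rfl fun r _ => ?_
            rw [← Nat.mul_sub, (even_two_mul _).neg_one_pow]; norm_num
        _ = 0 := by rw [← Finset.mul_sum, eulerNumber_sum a ha, mul_zero]
    · intro r _
      rw [eulerNumber_of_odd ⟨r, rfl⟩]; ring
  · rw [zero_pow (by omega), mul_zero]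
    refine Finset.sum_eq_zero fun i hi => ?_
    rcases Nat.even_or_odd i with h | h
    · have : Odd (2 * a + 1 - i) := by
        have := Finset.mem_range.1 hi
        exact Nat.Odd.sub_even (by omega) ⟨a, rfl⟩ h
      rw [this.neg_one_pow]; ring
    · rw [eulerNumber_of_odd h]; ring

theorem eulerFunctional_shift (f : ℤ[X]) :
    eulerFunctional (f.comp (X + 1) + f.comp (X - 1)) = 2 * f.eval 0 := by
  induction f using Polynomial.induction_on' with
  | add p q hp hq =>
    rw [add_comp, add_comp, add_add_add_comm, map_add, hp, hq, eval_add, mul_add]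
  | monomial n a =>
    rw [← C_mul_X_pow_eq_monomial, mul_comp, mul_comp, C_comp, C_comp, X_pow_comp, X_pow_comp,
      ← mul_add, ← smul_eq_C_mul, map_smul, eulerFunctional_shift_X_pow]
    simp only [smul_eq_mul, eval_mul, eval_C, eval_pow, eval_X]
    ring

/-! ### Central factorials and their moments. -/

/-- The polynomial `∏ (X² - i²)` over the first `s` odd `i`. -/
noncomputable def oddCentralFactorial (s : ℕ) : ℤ[X] :=
  ∏ i ∈ Finset.range s, (X ^ 2 - (2 * (i : ℤ[X]) + 1) ^ 2)

/-- The polynomial `∏ (X² - i²)` over the first `s` positive even `i`. -/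
noncomputable def evenCentralFactorial (s : ℕ) : ℤ[X] :=
  ∏ i ∈ Finset.range s, (X ^ 2 - (2 * (i : ℤ[X]) + 2) ^ 2)

theorem oddCentralFactorial_succ (s : ℕ) : oddCentralFactorial (s + 1) =
    oddCentralFactorial s * (X ^ 2 - (2 * (s : ℤ[X]) + 1) ^ 2) :=
  Finset.prod_range_succ _ _

theorem evenCentralFactorial_succ (s : ℕ) : evenCentralFactorial (s + 1) =
    evenCentralFactorial s * (X ^ 2 - (2 * (s : ℤ[X]) + 2) ^ 2) :=
  Finset.prod_range_succ _ _

/-- The roots -2s, ..., 2s in steps of 2 move to -2s-1, ..., 2s-1: the symmetric odd block and one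
extra root. -/
theorem X_mul_evenCentralFactorial_comp_add_one (s : ℕ) :
    (X * evenCentralFactorial s).comp (X + 1) =
      (X + 2 * (s : ℤ[X]) + 1) * oddCentralFactorial s := by
  induction s with
  | zero => simp [evenCentralFactorial, oddCentralFactorial]
  | succ s ih =>
    rw [evenCentralFactorial_succ, ← mul_assoc, mul_comp, ih, oddCentralFactorial_succ]
    simp only [sub_comp, pow_comp, add_comp, mul_comp, X_comp, ofNat_comp, natCast_comp]
    push_cast
    ring

theorem X_mul_evenCentralFactorial_comp_sub_one (s : ℕ) :
    (X * evenCentralFactorial s).comp (X - 1) =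
      (X - 2 * (s : ℤ[X]) - 1) * oddCentralFactorial s := by
  induction s with
  | zero => simp [evenCentralFactorial, oddCentralFactorial]
  | succ s ih =>
    rw [evenCentralFactorial_succ, ← mul_assoc, mul_comp, ih, oddCentralFactorial_succ]
    simp only [sub_comp, pow_comp, add_comp, mul_comp, X_comp, ofNat_comp, natCast_comp]
    push_cast
    ring

/-- The shift identity for X² times the even product, which vanishes at 0, relates the values at s
and s + 1. -/
theorem eulerFunctional_oddCentralFactorial (s : ℕ) :
    eulerFunctional (oddCentralFactorial s) = (-1) ^ s * ((2 * s).factorial : ℤ) := by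
  induction s with
  | zero => simpa [oddCentralFactorial, eulerNumber_zero] using eulerFunctional_X_pow 0
  | succ s ih =>
    have key := eulerFunctional_shift (X * (X * evenCentralFactorial s))
    have expand : (X * (X * evenCentralFactorial s)).comp (X + 1) +
        (X * (X * evenCentralFactorial s)).comp (X - 1) =
        (2 : ℤ) • (oddCentralFactorial (s + 1) +
          ((2 * s + 2) * (2 * s + 1) : ℤ) • oddCentralFactorial s) := by
      rw [mul_comp, mul_comp X _ (X - 1), X_mul_evenCentralFactorial_comp_add_one,
        X_mul_evenCentralFactorial_comp_sub_one, oddCentralFactorial_succ, X_comp, X_comp,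
        zsmul_eq_mul, zsmul_eq_mul]
      push_cast
      ring
    rw [expand, map_smul, map_add, map_smul, ih, eval_mul, eval_X, zero_mul, smul_eq_mul,
      smul_eq_mul] at key
    rw [show 2 * (s + 1) = 2 * s + 1 + 1 by ring, Nat.factorial_succ, Nat.factorial_succ]
    push_cast
    linear_combination mul_left_cancel₀ two_ne_zero key

/-- The value of `eulerFunctional` at `(X² - 1) ^ r * oddCentralFactorial s`. -/
def eulerMoment : ℕ → ℕ → ℤ
  | 0, s => (-1) ^ s * ((2 * s).factorial : ℤ)
  | r + 1, s => eulerMoment r (s + 1) + 4 * (s : ℤ) * (s + 1) * eulerMoment r s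

/-- The recursion comes from X² - 1 = (X² - (2s+1)²) + 4s(s+1). -/
theorem eulerFunctional_eq_eulerMoment (r s : ℕ) :
    eulerFunctional ((X ^ 2 - 1) ^ r * oddCentralFactorial s) = eulerMoment r s := by
  induction r generalizing s with
  | zero => rw [pow_zero, one_mul, eulerFunctional_oddCentralFactorial, eulerMoment]
  | succ r ih =>
    have : (X ^ 2 - 1) ^ (r + 1) * oddCentralFactorial s =
        (X ^ 2 - 1) ^ r * oddCentralFactorial (s + 1) +
          (4 * (s : ℤ) * (s + 1)) • ((X ^ 2 - 1) ^ r * oddCentralFactorial s) := by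
      rw [oddCentralFactorial_succ, zsmul_eq_mul]
      push_cast
      ring
    rw [this, map_add, map_smul, ih, ih, eulerMoment, smul_eq_mul]

theorem two_pow_dvd_two_mul_factorial (s : ℕ) : 2 ^ (3 * s / 2) ∣ (2 * s).factorial := by
  induction s using Nat.twoStepInduction with
  | zero => decide
  | one => decide
  | more s ih _ =>
    obtain ⟨c, hc⟩ := Nat.even_mul_succ_self (s + 1)
    have : (2 * (s + 2)).factorial =
        2 ^ 3 * (2 * s).factorial * (c * (2 * s + 3) * (2 * s + 1)) := by
      rw [show 2 * (s + 2) = 2 * s + 1 + 1 + 1 + 1 by ring, Nat.factorial_succ, Nat.factorial_succ,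
        Nat.factorial_succ, Nat.factorial_succ]
      linear_combination (4 * (2 * s + 3) * (2 * s + 1) * (2 * s).factorial) * hc
    rw [this, show 3 * (s + 2) / 2 = 3 + 3 * s / 2 by omega, pow_add]
    exact Dvd.dvd.mul_right (mul_dvd_mul_left _ ih) _

theorem two_pow_dvd_eulerMoment (r s : ℕ) : (2 : ℤ) ^ (3 * (r + s) / 2) ∣ eulerMoment r s := by
  induction r generalizing s with
  | zero =>
    rw [eulerMoment, zero_add]
    exact Dvd.dvd.mul_left (by exact_mod_cast two_pow_dvd_two_mul_factorial s) _
  | succ r ih =>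
    rw [eulerMoment]
    refine dvd_add ?_ ?_
    · simpa only [add_assoc, add_comm 1 s] using ih (s + 1)
    -- The exponent grows by at most 2, which the factor 4 pays for.
    · refine (pow_dvd_pow 2 (show 3 * (r + 1 + s) / 2 ≤ 2 + 3 * (r + s) / 2 by omega)).trans ?_
      rw [pow_add]
      exact mul_dvd_mul ⟨s * (s + 1), by ring⟩ (ih s)

theorem eulerFunctional_mul_X_pow_two_mul (f : ℤ[X]) (j : ℕ) :
    eulerFunctional (f * X ^ (2 * j)) =
      ∑ r ∈ Finset.range (j + 1), (j.choose r : ℤ) * eulerFunctional (f * (X ^ 2 - 1) ^ r) := by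
  have : f * X ^ (2 * j) =
      ∑ r ∈ Finset.range (j + 1), (j.choose r : ℤ) • (f * (X ^ 2 - 1) ^ r) := by
    rw [pow_mul, ← sub_add_cancel (X ^ 2 : ℤ[X]) 1, add_pow, Finset.mul_sum]
    refine Finset.sum_congr rfl fun r _ => ?_
    rw [zsmul_eq_mul]
    simp only [add_sub_cancel_right, one_pow, Int.cast_natCast]
    ring
  rw [this, map_sum]
  exact Finset.sum_congr rfl fun r _ => by rw [map_smul, smul_eq_mul]

theorem eulerFunctional_sq_sub_one_pow (r : ℕ) :
    eulerFunctional ((X ^ 2 - 1) ^ r) = eulerMoment r 0 := by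
  simpa [oddCentralFactorial] using eulerFunctional_eq_eulerMoment r 0

theorem eulerNumber_two_mul (j : ℕ) : eulerNumber (2 * j) =
    ∑ r ∈ Finset.range (j + 1), (j.choose r : ℤ) * eulerMoment r 0 := by
  simpa [eulerFunctional_sq_sub_one_pow, eulerFunctional_X_pow] using
    eulerFunctional_mul_X_pow_two_mul 1 j

/-- The extra factor X² = 1 + (X² - 1) adds the next moment to each term. -/
theorem eulerNumber_two_mul_add_two (j : ℕ) : eulerNumber (2 * j + 2) =
    ∑ r ∈ Finset.range (j + 1),
      (j.choose r : ℤ) * (eulerMoment r 0 + eulerMoment (r + 1) 0) := by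
  have h := eulerFunctional_mul_X_pow_two_mul (X ^ 2) j
  rw [← pow_add, add_comm 2, eulerFunctional_X_pow] at h
  rw [h]
  refine Finset.sum_congr rfl fun r _ => ?_
  rw [← eulerFunctional_sq_sub_one_pow, ← eulerFunctional_sq_sub_one_pow, ← map_add]
  congr 2
  ring

/-! ### Truncating the binomial sum. -/

theorem two_mul_le_two_pow (v : ℕ) : 2 * v ≤ 2 ^ v := by
  induction v with
  | zero => simp
  | succ v ih =>
    rcases v with _ | v
    · simp
    · rw [pow_succ]; omega

/-- Since r C(j,r) = j C(j-1,r-1), the binomial coefficient loses at most the 2-adic valuation v of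
r, and v + 8 ≤ ⌊3r/2⌋ for r ≥ 6, with equality at r = 6. -/
theorem two_pow_dvd_choose_mul {n j r : ℕ} {x : ℤ} (hj : 2 ^ n ∣ j) (hr : 6 ≤ r)
    (hx : (2 : ℤ) ^ (3 * r / 2) ∣ x) : (2 : ℤ) ^ (n + 8) ∣ j.choose r * x := by
  rcases j with _ | j
  · rw [Nat.choose_eq_zero_of_lt (by omega)]; simp
  obtain ⟨v, u, hu, rfl⟩ := Nat.exists_eq_two_pow_mul_odd (n := r) (by omega)
  have hv : v + 8 ≤ 3 * (2 ^ v * u) / 2 := by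
    have h1 := two_mul_le_two_pow v
    have h2 : 2 ^ v ≤ 2 ^ v * u := Nat.le_mul_of_pos_right _ hu.pos
    rcases Nat.lt_or_ge v 2 with hv | hv
    · omega
    · obtain ⟨w, rfl⟩ := Nat.exists_eq_add_of_le hv
      have h3 : 2 ^ (2 + w) * u = 4 * (2 ^ w * u) := by ring
      omega
  have hdiv : 2 ^ n ∣ 2 ^ v * (j + 1).choose (2 ^ v * u) := by
    have h : 2 ^ n ∣ u * (2 ^ v * (j + 1).choose (2 ^ v * u)) := by
      obtain ⟨q, hq⟩ := Nat.exists_eq_succ_of_ne_zero (n := 2 ^ v * u) (by omega)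
      have := Nat.add_one_mul_choose_eq j q
      refine (hj.mul_right (j.choose q)).trans (dvd_of_eq ?_)
      rw [this, ← Nat.succ_eq_add_one q, ← hq]
      ring
    exact (Nat.Coprime.pow_left n (Nat.coprime_two_left.2 hu)).dvd_of_dvd_mul_left h
  have hdiv' : (2 : ℤ) ^ n ∣ 2 ^ v * ((j + 1).choose (2 ^ v * u) : ℤ) := by exact_mod_cast hdiv
  have := mul_dvd_mul hdiv' ((pow_dvd_pow 2 hv).trans hx)
  rw [pow_add, ← mul_assoc, mul_comm _ ((2 : ℤ) ^ v), mul_assoc, mul_assoc,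
    mul_dvd_mul_iff_left (by positivity)] at this
  rwa [pow_add]

theorem sum_choose_mul_modEq {n j : ℕ} (hj : 2 ^ n ∣ j) (a : ℕ → ℤ)
    (ha : ∀ r, (2 : ℤ) ^ (3 * r / 2) ∣ a r) :
    ∑ r ∈ Finset.range (j + 1), (j.choose r : ℤ) * a r ≡
      ∑ r ∈ Finset.range 6, (j.choose r : ℤ) * a r [ZMOD 2 ^ (n + 8)] := by
  -- The longer range contains the first six indices even when j < 5.
  have h : ∑ r ∈ Finset.range (j + 1), (j.choose r : ℤ) * a r =
      ∑ r ∈ Finset.range (6 + j), (j.choose r : ℤ) * a r := by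
    refine Finset.sum_subset (Finset.range_mono (by omega)) fun r _ hr => ?_
    rw [Nat.choose_eq_zero_of_lt (by simpa using hr)]
    simp
  rw [h, Finset.sum_range_add]
  refine (Int.modEq_iff_dvd.2 ?_).symm
  rw [add_sub_cancel_left]
  exact Finset.dvd_sum fun r _ => two_pow_dvd_choose_mul hj (by omega) (ha _)

theorem choose_succ_mul_cast (j r : ℕ) :
    (j.choose (r + 1) : ℤ) * (r + 1) = j.choose r * (j - r) := by
  rcases le_or_gt r j with h | h
  · rw [← Nat.cast_sub h]
    exact_mod_cast Nat.choose_succ_right_eq j r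
  · rw [Nat.choose_eq_zero_of_lt h, Nat.choose_eq_zero_of_lt (by omega)]
    simp

theorem one_hundred_twenty_mul_sum_choose (j : ℕ) (a : ℕ → ℤ) :
    120 * ∑ r ∈ Finset.range 6, (j.choose r : ℤ) * a r =
      120 * a 0 + 120 * j * a 1 + 60 * j * (j - 1) * a 2 + 20 * j * (j - 1) * (j - 2) * a 3 +
        5 * j * (j - 1) * (j - 2) * (j - 3) * a 4 +
        j * (j - 1) * (j - 2) * (j - 3) * (j - 4) * a 5 := by
  have h2 := choose_succ_mul_cast j 1
  have h3 := choose_succ_mul_cast j 2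
  have h4 := choose_succ_mul_cast j 3
  have h5 := choose_succ_mul_cast j 4
  norm_num at h2 h3 h4 h5
  simp only [Finset.sum_range_succ, Finset.sum_range_zero, Nat.choose_zero_right,
    Nat.choose_one_right]
  push_cast
  generalize (j : ℤ) = y at *
  linear_combination (60 * a 2 + 20 * (y - 2) * a 3 + 5 * (y - 2) * (y - 3) * a 4 +
      (y - 2) * (y - 3) * (y - 4) * a 5) * h2 +
    (40 * a 3 + 10 * (y - 3) * a 4 + 2 * (y - 3) * (y - 4) * a 5) * h3 +
    (30 * a 4 + 6 * (y - 4) * a 5) * h4 + 24 * a 5 * h5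

/-- The left side of `h` is 15 = 120/8 times the six-term sum; 15 is invertible modulo powers of 2,
and 256 j supplies 2^(n+8). -/
theorem eulerNumber_two_mul_modEq {n j : ℕ} (hj : 2 ^ n ∣ j) {c q : ℤ}
    (h : 15 - 181066 * (j : ℤ) + 375300 * j ^ 2 - 260680 * j ^ 3 + 73680 * j ^ 4 - 7264 * j ^ 5 =
      15 * c + j * (256 * q)) :
    eulerNumber (2 * j) ≡ c [ZMOD 2 ^ (n + 8)] := by
  rw [eulerNumber_two_mul]
  refine (sum_choose_mul_modEq hj _ fun r => two_pow_dvd_eulerMoment r 0).trans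
    (Int.modEq_iff_dvd.2 ?_).symm
  have hs := one_hundred_twenty_mul_sum_choose j fun r => eulerMoment r 0
  generalize ∑ r ∈ Finset.range 6, (j.choose r : ℤ) * eulerMoment r 0 = S at hs ⊢
  rw [show eulerMoment 0 0 = 1 by decide, show eulerMoment 1 0 = -2 by decide,
    show eulerMoment 2 0 = 8 by decide, show eulerMoment 3 0 = -80 by decide,
    show eulerMoment 4 0 = 1664 by decide, show eulerMoment 5 0 = -58112 by decide] at hs
  have hS : 15 * (S - c) = j * 2 ^ 8 * q := by linarith
  have hj' : (2 : ℤ) ^ n ∣ j := by exact_mod_cast hj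
  have hc : IsCoprime (2 : ℤ) 15 := ⟨-7, 1, by norm_num⟩
  refine hc.pow_left.dvd_of_dvd_mul_left ?_
  rw [hS, pow_add]
  exact (mul_dvd_mul_right hj' _).mul_right _

theorem eulerNumber_two_mul_add_two_modEq {n j : ℕ} (hj : 2 ^ n ∣ j) {c q : ℤ}
    (h : -15 + 9129798 * (j : ℤ) - 18962100 * j ^ 2 + 13208760 * j ^ 3 - 3747600 * j ^ 4 +
      371232 * j ^ 5 = 15 * c + j * (256 * q)) :
    eulerNumber (2 * j + 2) ≡ c [ZMOD 2 ^ (n + 8)] := by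
  rw [eulerNumber_two_mul_add_two]
  refine (sum_choose_mul_modEq hj (fun r => eulerMoment r 0 + eulerMoment (r + 1) 0) fun r =>
    dvd_add (two_pow_dvd_eulerMoment r 0) ((pow_dvd_pow 2 (by omega)).trans
      (two_pow_dvd_eulerMoment (r + 1) 0))).trans (Int.modEq_iff_dvd.2 ?_).symm
  have hs := one_hundred_twenty_mul_sum_choose j fun r => eulerMoment r 0 + eulerMoment (r + 1) 0
  generalize ∑ r ∈ Finset.range 6, (j.choose r : ℤ) * (eulerMoment r 0 + eulerMoment (r + 1) 0) = S
    at hs ⊢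
  norm_num only at hs
  rw [show eulerMoment 0 0 = 1 by decide, show eulerMoment 1 0 = -2 by decide,
    show eulerMoment 2 0 = 8 by decide, show eulerMoment 3 0 = -80 by decide,
    show eulerMoment 4 0 = 1664 by decide, show eulerMoment 5 0 = -58112 by decide,
    show eulerMoment 6 0 = 3027968 by decide] at hs
  have hS : 15 * (S - c) = j * 2 ^ 8 * q := by linarith
  have hj' : (2 : ℤ) ^ n ∣ j := by exact_mod_cast hj
  have hc : IsCoprime (2 : ℤ) 15 := ⟨-7, 1, by norm_num⟩
  refine hc.pow_left.dvd_of_dvd_mul_left ?_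
  rw [hS, pow_add]
  exact (mul_dvd_mul_right hj' _).mul_right _

theorem corollary2p1 (k m : ℕ) (hk : 1 ≤ k) (hm : 2 ≤ m) :
    (m = 2 → eulerNumber (2 ^ m * k) ≡
      4 * (k : ℤ) * (-48 * (k : ℤ) ^ 2 + 60 * (k : ℤ) - 11) + 1 [ZMOD 2 ^ (m + 7)]) ∧
    (3 ≤ m → eulerNumber (2 ^ m * k) ≡
      2 ^ m * (k : ℤ) * (-11 + 7 * (2 ^ m * (k : ℤ))) + 1 [ZMOD 2 ^ (m + 7)]) ∧
    (m = 2 → eulerNumber (2 ^ m * k + 2) ≡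
      4 * (k : ℤ) * (-48 * (k : ℤ) ^ 2 - 12 * (k : ℤ) + 45) - 1 [ZMOD 2 ^ (m + 7)]) ∧
    (3 ≤ m → eulerNumber (2 ^ m * k + 2) ≡
      2 ^ m * (k : ℤ) * (45 + 5 * (2 ^ m * (k : ℤ))) - 1 [ZMOD 2 ^ (m + 7)]) := by
  have two_adic (h3 : 3 ≤ m) : ∃ t, 2 ^ m * k = 2 * (4 * t) ∧ 2 ^ (m - 1) ∣ 4 * t := by
    obtain ⟨d, rfl⟩ := Nat.exists_eq_add_of_le h3
    exact ⟨2 ^ d * k, by ring, k, by rw [show 3 + d - 1 = 2 + d by omega]; ring⟩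
  have cast_eq {t : ℕ} (ht : 2 ^ m * k = 2 * (4 * t)) : (2 : ℤ) ^ m * k = 2 * (4 * t) := by
    exact_mod_cast ht
  refine ⟨?_, fun h3 => ?_, ?_, fun h3 => ?_⟩
  · rintro rfl
    -- Dividing by 256 j leaves a half-integral multiple of k²(k+1); w = k(k+1)/2 makes the quotient
    -- q integral.
    obtain ⟨w, hw⟩ := Int.even_mul_succ_self (k : ℤ)
    rw [show 2 ^ 2 * k = 2 * (2 * k) by ring]
    refine eulerNumber_two_mul_modEq (n := 1) (q := -706 + 2925 * k + 4605 * k * w - 6370 * k ^ 2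
      - 454 * k ^ 4) (Dvd.intro _ (by ring)) ?_
    push_cast
    linear_combination (2 * (k : ℤ)) * 128 * 4605 * k * hw
  -- For m ≥ 3, j = 4t, so the cubic and higher terms in j are absorbed by 256 j.
  · obtain ⟨t, ht, hd⟩ := two_adic h3
    obtain ⟨w, hw⟩ := Int.even_mul_succ_self (t : ℤ)
    rw [cast_eq ht, ht, show m + 7 = m - 1 + 8 by omega]
    refine eulerNumber_two_mul_modEq (q := -706 + 11715 * w - 22150 * t ^ 2 + 18420 * t ^ 3
      - 7264 * t ^ 4) hd ?_
    push_cast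
    linear_combination (4 * (t : ℤ)) * 128 * 11715 * hw
  · rintro rfl
    obtain ⟨w, hw⟩ := Int.even_mul_succ_self (k : ℤ)
    rw [show 2 ^ 2 * k = 2 * (2 * k) by ring]
    refine eulerNumber_two_mul_add_two_modEq (n := 1) (q := 35658 - 148140 * k - 234225 * k * w
      + 323505 * k ^ 2 + 23202 * k ^ 4) (Dvd.intro _ (by ring)) ?_
    push_cast
    linear_combination (2 * (k : ℤ)) * 128 * (-234225) * k * hw
  · obtain ⟨t, ht, hd⟩ := two_adic h3
    obtain ⟨w, hw⟩ := Int.even_mul_succ_self (t : ℤ)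
    rw [cast_eq ht, ht, show m + 7 = m - 1 + 8 by omega]
    refine eulerNumber_two_mul_add_two_modEq (q := 35658 + 1651095 * w - 1121835 * t
      - 936900 * t ^ 3 + 371232 * t ^ 4) hd ?_
    push_cast
    linear_combination (4 * (t : ℤ)) * 128 * 1651095 * hw
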